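/- Let $d\ge 2$ be an integer and let $\mathcal{M}_d$ be the $d$-th multibrot set, i.e. the set of all $t\in\mathbb{C}$ such that the orbit of $0$ under the map $z\mapsto z^d+t$ is bounded. If $A,B\in\mathbb{C}$ and the affine map $\mu(z)=Az+B$ satisfies $\mu(\mathcal{M}_d)=\mathcal{M}_d$, then $B=0$ and $A$ is a $(d-1)$-st root of unity, that is, $A^{d-1}=1$. Conversely, for every $\xi\in\mathbb{C}$ with $\xi^{d-1}=1$, the rotation $z\mapsto \xi z$ maps $\mathcal{M}_d$ onto itself. -/

import Mathlib

/-- The `d`-th multibrot set: all `t : ℂ` such that the orbit of `0` under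
`z ↦ z ^ d + t` is bounded. -/
def multibrot (d : ℕ) : Set ℂ :=
  {t : ℂ | Bornology.IsBounded (Set.range fun n : ℕ => (fun z : ℂ => z ^ d + t)^[n] 0)}

/-!
Let `P n` be the monic polynomial of degree `d ^ n` whose value at `t` is the `(n + 1)`-st iterate
of `0` under `z ↦ z ^ d + t`. The lemniscates `‖P n‖ ≤ 2` shrink to the multibrot set, so a
polynomial `q` of degree `d ^ n` bounded by `K` on the multibrot set satisfies a Bernstein–Walsh
inequality: `‖q‖ ≤ K G ^ (d ^ n)` outside the set, with `G = lim ‖P n‖ ^ (1 / d ^ n)` the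
exponential of the Green function. An affine map `μ z = A z + B` preserving the multibrot set
preserves its diameter, so `‖A‖ = 1`. Applying the inequality to `P (n + i) ∘ μ` and taking
`d ^ i`-th roots removes the constant as `i → ∞`, whence `G ∘ μ ≤ G`. Since
`G ^ (d ^ n) = ‖P n‖ + o(1)` near infinity for `n ≥ 1`, this gives `‖P n ∘ μ‖ ≤ ‖P n‖ + o(1)`, which
is only possible if `P n ∘ μ = A ^ (d ^ n) P n`. Comparing `n = 1` with `n = 2` through
`P 2 = P 1 ^ d + X` makes `μ` linear, and `P 1 = X ^ d + X` then forces `A ^ d = A`.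
-/

open Polynomial Filter Bornology Asymptotics Topology Pointwise

/-! ### Growth near infinity -/

theorem le_of_frequently_pow_le_mul_pow {u v K : ℝ} (hv : 0 ≤ v)
    (h : ∃ᶠ n : ℕ in atTop, u ^ n ≤ K * v ^ n) : u ≤ v := by
  by_contra! huv
  have hsmall : Tendsto (fun n : ℕ => K * (v / u) ^ n) atTop (𝓝 0) := by
    simpa using (tendsto_pow_atTop_nhds_zero_of_lt_one (div_nonneg hv (hv.trans huv.le))
      ((div_lt_one (hv.trans_lt huv)).mpr huv)).const_mul K
  refine h ((hsmall.eventually_lt_const one_pos).mono fun n hn => not_le.mpr ?_)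
  rwa [div_pow, ← mul_div_assoc, div_lt_one (pow_pos (hv.trans_lt huv) n)] at hn

theorem tendsto_eval_div_eval_cobounded {𝕜 : Type*} [NormedField 𝕜] {p q : 𝕜[X]}
    (h : p.natDegree = q.natDegree) :
    Tendsto (fun t => p.eval t / q.eval t) (cobounded 𝕜)
      (𝓝 (p.leadingCoeff / q.leadingCoeff)) := by
  have hequiv := (isEquivalent_cobounded_leading_monomial (P := p)).div
    (isEquivalent_cobounded_leading_monomial (P := q))
  refine hequiv.symm.tendsto_nhds (tendsto_const_nhds.congr' ?_)
  filter_upwards [eventually_ne_cobounded (0 : 𝕜)] with t ht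
  simp only [h, Pi.div_apply]
  exact (mul_div_mul_right _ _ (pow_ne_zero _ ht)).symm

/- Along the ray through a `j`-th root of `b`, the limit of `t ^ j * f t / b` is the limit of
`‖t‖ ^ j * f t / ‖b‖`, whose real part cannot tend to `1`. -/
theorem eq_zero_of_tendsto_pow_mul_of_norm_pow_mul_re_le {f : ℂ → ℂ} {δ : ℂ → ℝ} {b : ℂ} {j : ℕ}
    (hj : j ≠ 0) (hf : Tendsto (fun t => t ^ j * f t) (cobounded ℂ) (𝓝 b))
    (hδ : Tendsto δ (cobounded ℂ) (𝓝 0)) (h : ∀ᶠ t in cobounded ℂ, ‖t‖ ^ j * (f t).re ≤ δ t) :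
    b = 0 := by
  by_contra hb
  obtain ⟨ω, hω⟩ := IsAlgClosed.exists_pow_nat_eq b (Nat.pos_of_ne_zero hj)
  have hω0 : ω ≠ 0 := ne_zero_pow hj (hω ▸ hb)
  have hray : Tendsto (fun r : ℝ => (r : ℂ) * ω) atTop (cobounded ℂ) :=
    (tendsto_mul_right_cobounded hω0).comp (RCLike.tendsto_ofReal_atTop_cobounded ℂ)
  have hlim : Tendsto (fun r : ℝ => ‖b‖ * ((r * ω) ^ j * f (r * ω) / b).re) atTop (𝓝 ‖b‖) := by
    have hquot := (hf.comp hray).div_const b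
    rw [div_self hb] at hquot
    simpa using ((Complex.continuous_re.tendsto 1).comp hquot).const_mul ‖b‖
  refine (norm_pos_iff.mpr hb).not_ge (le_of_tendsto_of_tendsto hlim (hδ.comp hray) ?_)
  filter_upwards [hray.eventually h, eventually_ge_atTop 0] with r hr hr0
  refine le_of_eq_of_le ?_ hr
  have hquot : (r * ω) ^ j * f (r * ω) / b = ((r ^ j : ℝ) : ℂ) * f (r * ω) := by
    rw [mul_pow, hω, Complex.ofReal_pow]
    field_simp
  rw [hquot, Complex.re_ofReal_mul, ← norm_pow, mul_pow, hω, norm_mul, norm_pow,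
    Complex.norm_of_nonneg hr0]
  ring

theorem re_sub_div_le_div_norm {z w : ℂ} {e : ℝ} (h : ‖w‖ ≤ ‖z‖ + e) :
    ((w - z) / z).re ≤ e / ‖z‖ := by
  rcases eq_or_ne z 0 with rfl | hz
  · simp
  have hz' : 0 < ‖z‖ := norm_pos_iff.mpr hz
  have hre : (w / z).re ≤ 1 + e / ‖z‖ :=
    calc (w / z).re ≤ ‖w‖ / ‖z‖ := (Complex.re_le_norm _).trans_eq (norm_div w z)
      _ ≤ (‖z‖ + e) / ‖z‖ := by gcongr
      _ = 1 + e / ‖z‖ := by rw [add_div, div_self hz'.ne']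
  rw [sub_div, div_self hz, Complex.sub_re, Complex.one_re]
  linarith

theorem eq_of_norm_eval_le_norm_eval_add {p q : ℂ[X]} (hdeg : q.natDegree = p.natDegree)
    (hlc : q.leadingCoeff = p.leadingCoeff) {ε : ℂ → ℝ} (hε : Tendsto ε (cobounded ℂ) (𝓝 0))
    (h : ∀ᶠ t in cobounded ℂ, ‖q.eval t‖ ≤ ‖p.eval t‖ + ε t) : q = p := by
  by_contra hne
  have hD : q - p ≠ 0 := sub_ne_zero.mpr hne
  have hp : p ≠ 0 := by
    rintro rfl
    rw [leadingCoeff_zero, leadingCoeff_eq_zero] at hlc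
    exact hne hlc
  have hq : q ≠ 0 := leadingCoeff_ne_zero.mp (hlc ▸ leadingCoeff_ne_zero.mpr hp)
  have hlt : (q - p).natDegree < p.natDegree := natDegree_lt_natDegree hD <|
    degree_sub_lt_right (by rw [degree_eq_natDegree hq, degree_eq_natDegree hp, hdeg]) hp hlc
  obtain ⟨j, hj⟩ := Nat.exists_eq_add_of_lt hlt
  have hlim : Tendsto (fun t => t ^ (j + 1) * ((q - p).eval t / p.eval t)) (cobounded ℂ)
      (𝓝 ((X ^ (j + 1) * (q - p)).leadingCoeff / p.leadingCoeff)) := by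
    refine (tendsto_eval_div_eval_cobounded ?_).congr fun t => ?_
    · rw [natDegree_X_pow_mul _ hD, hj, add_assoc]
    · rw [eval_mul, eval_pow, eval_X, mul_div_assoc]
  have hsmall : Tendsto (fun t => ‖t‖ ^ (j + 1) * (ε t / ‖p.eval t‖)) (cobounded ℂ) (𝓝 0) := by
    have hpow : (X ^ (j + 1) : ℂ[X]).eval =O[cobounded ℂ] p.eval := by
      refine isBigO_cobounded_of_degree_le ?_
      rw [degree_X_pow, degree_eq_natDegree hp]
      exact_mod_cast (by omega : j + 1 ≤ p.natDegree)
    have hmul := hpow.norm_norm.mul_isLittleO ((isLittleO_one_iff ℝ).mpr hε)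
    simpa [mul_div_assoc] using hmul.tendsto_div_nhds_zero
  have hlead := eq_zero_of_tendsto_pow_mul_of_norm_pow_mul_re_le j.succ_ne_zero hlim hsmall <| by
    filter_upwards [h] with t ht
    rw [eval_sub]
    gcongr
    exact re_sub_div_le_div_norm ht
  simp [hD, hp] at hlead

/-! ### The maximum principle on unbounded sets -/

theorem norm_le_of_forall_mem_frontier_of_eventually_cobounded {E F : Type*}
    [NormedAddCommGroup E] [NormedSpace ℂ E] [Nontrivial E] [NormedAddCommGroup F]
    [NormedSpace ℂ F] {f : E → F} {U : Set E} {K : ℝ} (hf : DiffContOnCl ℂ f U)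
    (hfr : ∀ z ∈ frontier U, ‖f z‖ ≤ K) (hinf : ∀ᶠ z in cobounded E, ‖f z‖ ≤ K) {z : E}
    (hz : z ∈ U) : ‖f z‖ ≤ K := by
  obtain ⟨r, hr⟩ : ∃ r, ∀ w : E, r ≤ ‖w‖ → ‖f w‖ ≤ K := by
    simpa using hasBasis_cobounded_norm.eventually_iff.mp hinf
  set s := max r (‖z‖ + 1)
  have hzs : z ∈ Metric.ball 0 s :=
    mem_ball_zero_iff.mpr ((lt_add_one _).trans_le (le_max_right _ _))
  refine Complex.norm_le_of_forall_mem_frontier_norm_le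
    (Metric.isBounded_ball.subset Set.inter_subset_right) (hf.mono Set.inter_subset_left)
    (fun w hw => ?_) (subset_closure ⟨hz, hzs⟩)
  rcases frontier_inter_subset U (Metric.ball 0 s) hw with ⟨hwU, -⟩ | ⟨-, hws⟩
  · exact hfr w hwU
  · have hws' : ‖w‖ = s := mem_sphere_zero_iff_norm.mp (Metric.frontier_ball_subset_sphere hws)
    exact hr w ((le_max_left _ _).trans hws'.ge)

theorem norm_eval_le_mul_norm_eval_of_lemniscate {p q : ℂ[X]} (hdeg : q.natDegree = p.natDegree)
    {R K : ℝ} (hR : 0 < R) (hlc : ‖q.leadingCoeff‖ < K * ‖p.leadingCoeff‖)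
    (h : ∀ t, ‖p.eval t‖ = R → ‖q.eval t‖ ≤ K * R) {t : ℂ} (ht : R < ‖p.eval t‖) :
    ‖q.eval t‖ ≤ K * ‖p.eval t‖ := by
  have hp : p ≠ 0 := by
    rintro rfl
    simp only [eval_zero, norm_zero] at ht
    exact hR.not_gt ht
  have hinf : ∀ᶠ z in cobounded ℂ, ‖q.eval z / p.eval z‖ ≤ K := by
    refine ((tendsto_eval_div_eval_cobounded hdeg).norm.eventually_lt_const ?_).mono
      fun _ => le_of_lt
    rwa [norm_div, div_lt_iff₀ (norm_pos_iff.mpr (leadingCoeff_ne_zero.mpr hp))]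
  have hnorm : Continuous fun z => ‖p.eval z‖ := p.continuous.norm
  have hdiff : DiffContOnCl ℂ (fun z => q.eval z / p.eval z) {z | R < ‖p.eval z‖} := by
    refine DifferentiableOn.diffContOnCl fun z hz => ?_
    have hRz : R ≤ ‖p.eval z‖ := closure_lt_subset_le continuous_const hnorm hz
    exact (q.differentiableAt.div p.differentiableAt
      (norm_pos_iff.mp (hR.trans_le hRz))).differentiableWithinAt
  have hquot := norm_le_of_forall_mem_frontier_of_eventually_cobounded hdiff
    (fun z hz => ?_) hinf ht
  · rwa [norm_div, div_le_iff₀ (hR.trans ht)] at hquot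
  · have hzR : R = ‖p.eval z‖ := frontier_lt_subset_eq continuous_const hnorm hz
    rw [norm_div, ← hzR, div_le_iff₀ hR]
    exact h z hzR.symm

/-! ### Escape estimates for `z ↦ z ^ d + t` -/

section Escape

variable {𝕜 : Type*} [NormedField 𝕜] {d : ℕ} {t z : 𝕜} {c : ℝ}

theorem sub_one_mul_norm_le_norm_pow_add (hd : 2 ≤ d) (hz : 1 ≤ ‖z‖) (ht : ‖t‖ ≤ ‖z‖) :
    (‖z‖ - 1) * ‖z‖ ≤ ‖z ^ d + t‖ :=
  calc (‖z‖ - 1) * ‖z‖ = ‖z‖ ^ 2 - ‖z‖ := by ring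
    _ ≤ ‖z‖ ^ d - ‖t‖ := sub_le_sub (pow_le_pow_right₀ hz hd) ht
    _ ≤ ‖z ^ d + t‖ := by rw [← norm_pow]; exact norm_sub_le_norm_add _ _

theorem sub_one_pow_mul_norm_le_norm_iterate (hd : 2 ≤ d) (hz : 2 ≤ ‖z‖) (ht : ‖t‖ ≤ ‖z‖)
    (n : ℕ) : (‖z‖ - 1) ^ n * ‖z‖ ≤ ‖(fun w => w ^ d + t)^[n] z‖ := by
  induction n with
  | zero => simp
  | succ n ih =>
    rw [Function.iterate_succ_apply']
    set w := (fun w => w ^ d + t)^[n] z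
    have hzw : ‖z‖ ≤ ‖w‖ :=
      (le_mul_of_one_le_left (norm_nonneg z) (one_le_pow₀ (by linarith))).trans ih
    calc (‖z‖ - 1) ^ (n + 1) * ‖z‖ = (‖z‖ - 1) * ((‖z‖ - 1) ^ n * ‖z‖) := by ring
      _ ≤ (‖w‖ - 1) * ‖w‖ :=
        mul_le_mul (by linarith) ih (mul_nonneg (pow_nonneg (by linarith) n) (norm_nonneg z))
          (by linarith)
      _ ≤ ‖w ^ d + t‖ := sub_one_mul_norm_le_norm_pow_add hd (by linarith) (ht.trans hzw)

theorem norm_le_norm_iterate (hd : 2 ≤ d) (hz : 2 ≤ ‖z‖) (ht : ‖t‖ ≤ ‖z‖) (n : ℕ) :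
    ‖z‖ ≤ ‖(fun w => w ^ d + t)^[n] z‖ :=
  (le_mul_of_one_le_left (norm_nonneg z) (one_le_pow₀ (by linarith))).trans
    (sub_one_pow_mul_norm_le_norm_iterate hd hz ht n)

theorem norm_pow_add_add_le (hd : d ≠ 0) (hc : 0 ≤ c) (h : ‖t‖ + c ≤ c * ‖z‖ ^ (d - 1)) :
    ‖z ^ d + t‖ + c ≤ (‖z‖ + c) ^ d :=
  calc ‖z ^ d + t‖ + c ≤ ‖z‖ ^ d + ‖t‖ + c := by grw [norm_add_le, norm_pow]
    _ ≤ ‖z‖ ^ d + c * ‖z‖ ^ (d - 1) := by linarith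
    _ = (‖z‖ + c) * ‖z‖ ^ (d - 1) := by rw [add_mul, mul_pow_sub_one hd]
    _ ≤ (‖z‖ + c) * (‖z‖ + c) ^ (d - 1) := by gcongr; linarith
    _ = (‖z‖ + c) ^ d := mul_pow_sub_one hd _

theorem sub_pow_le_norm_pow_add_sub (hd : d ≠ 0) (hc : 0 ≤ c) (hcz : c ≤ ‖z‖)
    (h : ‖t‖ + c ≤ c * ‖z‖ ^ (d - 1)) : (‖z‖ - c) ^ d ≤ ‖z ^ d + t‖ - c :=
  calc (‖z‖ - c) ^ d = (‖z‖ - c) * (‖z‖ - c) ^ (d - 1) := (mul_pow_sub_one hd _).symm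
    _ ≤ (‖z‖ - c) * ‖z‖ ^ (d - 1) :=
        mul_le_mul_of_nonneg_left
          (pow_le_pow_left₀ (sub_nonneg.mpr hcz) (sub_le_self _ hc) _) (sub_nonneg.mpr hcz)
    _ = ‖z‖ ^ d - c * ‖z‖ ^ (d - 1) := by rw [sub_mul, mul_pow_sub_one hd]
    _ ≤ ‖z ^ d‖ - ‖t‖ - c := by rw [norm_pow]; linarith
    _ ≤ ‖z ^ d + t‖ - c := by gcongr; exact norm_sub_le_norm_add _ _

theorem norm_iterate_add_le (hd : 2 ≤ d) (hz : 2 ≤ ‖z‖) (ht : ‖t‖ ≤ ‖z‖) (hc : 0 ≤ c)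
    (h : ‖t‖ + c ≤ c * ‖z‖ ^ (d - 1)) (n : ℕ) :
    ‖(fun w => w ^ d + t)^[n] z‖ + c ≤ (‖z‖ + c) ^ d ^ n := by
  induction n with
  | zero => simp
  | succ n ih =>
    have hmono := norm_le_norm_iterate hd hz ht n
    rw [Function.iterate_succ_apply']
    calc _ ≤ (‖(fun w => w ^ d + t)^[n] z‖ + c) ^ d :=
          norm_pow_add_add_le (by omega) hc (h.trans (by gcongr))
      _ ≤ ((‖z‖ + c) ^ d ^ n) ^ d := by gcongr
      _ = (‖z‖ + c) ^ d ^ (n + 1) := by rw [← pow_mul, ← pow_succ]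

theorem sub_pow_le_norm_iterate_sub (hd : 2 ≤ d) (hz : 2 ≤ ‖z‖) (ht : ‖t‖ ≤ ‖z‖) (hc : 0 ≤ c)
    (hcz : c ≤ ‖z‖) (h : ‖t‖ + c ≤ c * ‖z‖ ^ (d - 1)) (n : ℕ) :
    (‖z‖ - c) ^ d ^ n ≤ ‖(fun w => w ^ d + t)^[n] z‖ - c := by
  induction n with
  | zero => simp
  | succ n ih =>
    have hmono := norm_le_norm_iterate hd hz ht n
    rw [Function.iterate_succ_apply']
    calc (‖z‖ - c) ^ d ^ (n + 1) = ((‖z‖ - c) ^ d ^ n) ^ d := by rw [← pow_mul, ← pow_succ]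
      _ ≤ (‖(fun w => w ^ d + t)^[n] z‖ - c) ^ d :=
          pow_le_pow_left₀ (pow_nonneg (sub_nonneg.mpr hcz) _) ih d
      _ ≤ _ := sub_pow_le_norm_pow_add_sub (by omega) hc (hcz.trans hmono) (h.trans (by gcongr))

end Escape

/-! ### Orbit polynomials -/

/-- The critical orbit of `z ↦ z ^ d + t` as a sequence of polynomials in the parameter `t`. The
indexing starts at the critical value, so that `orbitPoly d n` has degree `d ^ n`. -/
noncomputable def orbitPoly {R : Type*} [Semiring R] (d : ℕ) : ℕ → R[X]
  | 0 => X
  | n + 1 => orbitPoly d n ^ d + X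

section OrbitPoly

theorem eval_orbitPoly_add {R : Type*} [CommSemiring R] (d k n : ℕ) (t : R) :
    (orbitPoly d (k + n)).eval t = (fun z => z ^ d + t)^[n] ((orbitPoly d k).eval t) := by
  induction n with
  | zero => rfl
  | succ n ih =>
    rw [Function.iterate_succ_apply', ← ih, ← add_assoc, orbitPoly, eval_add, eval_pow, eval_X]

theorem eval_orbitPoly_eq_iterate {R : Type*} [CommSemiring R] (d n : ℕ) (t : R) :
    (orbitPoly d n).eval t = (fun z => z ^ d + t)^[n] t := by
  simpa [orbitPoly] using eval_orbitPoly_add d 0 n t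

theorem monic_orbitPoly_and_natDegree_orbitPoly {R : Type*} [Semiring R] [Nontrivial R] {d : ℕ}
    (hd : 2 ≤ d) (n : ℕ) :
    (orbitPoly d n : R[X]).Monic ∧ (orbitPoly d n : R[X]).natDegree = d ^ n := by
  induction n with
  | zero => exact ⟨monic_X, natDegree_X⟩
  | succ n ih =>
    obtain ⟨hmonic, hdeg⟩ := ih
    have hdegpow : (orbitPoly d n ^ d : R[X]).natDegree = d ^ (n + 1) := by
      rw [hmonic.natDegree_pow, hdeg, pow_succ']
    have hlt : (X : R[X]).natDegree < (orbitPoly d n ^ d : R[X]).natDegree := by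
      rw [hdegpow, natDegree_X]
      exact Nat.one_lt_pow n.succ_ne_zero hd
    exact ⟨(hmonic.pow d).add_of_left (degree_lt_degree hlt),
      (natDegree_add_eq_left_of_natDegree_lt hlt).trans hdegpow⟩

theorem monic_orbitPoly {R : Type*} [Semiring R] [Nontrivial R] {d : ℕ} (hd : 2 ≤ d) (n : ℕ) :
    (orbitPoly d n : R[X]).Monic :=
  (monic_orbitPoly_and_natDegree_orbitPoly hd n).1

theorem natDegree_orbitPoly {R : Type*} [Semiring R] [Nontrivial R] {d : ℕ} (hd : 2 ≤ d) (n : ℕ) :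
    (orbitPoly d n : R[X]).natDegree = d ^ n :=
  (monic_orbitPoly_and_natDegree_orbitPoly hd n).2

variable {𝕜 : Type*} [NormedField 𝕜] {d : ℕ} {t : 𝕜}

theorem norm_le_norm_eval_orbitPoly (hd : 2 ≤ d) (ht : 2 ≤ ‖t‖) (n : ℕ) :
    ‖t‖ ≤ ‖(orbitPoly d n).eval t‖ := by
  rw [eval_orbitPoly_eq_iterate]
  exact norm_le_norm_iterate hd ht le_rfl n

theorem norm_le_norm_eval_orbitPoly_of_two_le (hd : 2 ≤ d) {n : ℕ}
    (h : 2 ≤ ‖(orbitPoly d n).eval t‖) : ‖t‖ ≤ ‖(orbitPoly d n).eval t‖ := by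
  rcases le_total 2 ‖t‖ with ht | ht
  · exact norm_le_norm_eval_orbitPoly hd ht n
  · exact ht.trans h

theorem norm_eval_orbitPoly_le_add (hd : 2 ≤ d) {k : ℕ} (h : 2 ≤ ‖(orbitPoly d k).eval t‖)
    (n : ℕ) : ‖(orbitPoly d k).eval t‖ ≤ ‖(orbitPoly d (k + n)).eval t‖ := by
  rw [eval_orbitPoly_add]
  exact norm_le_norm_iterate hd h (norm_le_norm_eval_orbitPoly_of_two_le hd h) n

/-- The amount by which `‖orbitPoly d n‖` has to be raised or lowered at `t` so that its
`d ^ i`-th powers bound `‖orbitPoly d (n + i)‖` for all `i`. It tends to zero at infinity for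
`n ≠ 0`. -/
noncomputable def orbitError (d n : ℕ) (t : 𝕜) : ℝ :=
  2 * ‖t‖ / ‖(orbitPoly d n).eval t‖ ^ (d - 1)

theorem orbitError_nonneg (d n : ℕ) (t : 𝕜) : 0 ≤ orbitError d n t := by
  unfold orbitError
  positivity

theorem orbitError_mul_pow (hd : 2 ≤ d) (n : ℕ) (ht : 2 ≤ ‖t‖) :
    orbitError d n t * ‖(orbitPoly d n).eval t‖ ^ (d - 1) = 2 * ‖t‖ :=
  div_mul_cancel₀ _ (pow_ne_zero _ (by linarith [norm_le_norm_eval_orbitPoly hd ht n]))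

theorem orbitError_le_norm (hd : 2 ≤ d) (n : ℕ) (ht : 2 ≤ ‖t‖) : orbitError d n t ≤ ‖t‖ := by
  have hP : 2 ≤ ‖(orbitPoly d n).eval t‖ := ht.trans (norm_le_norm_eval_orbitPoly hd ht n)
  have hpow : 2 ≤ ‖(orbitPoly d n).eval t‖ ^ (d - 1) :=
    hP.trans (le_self_pow₀ (by linarith) (by omega))
  have := mul_le_mul_of_nonneg_left hpow (orbitError_nonneg d n t)
  linarith [orbitError_mul_pow hd n ht]

theorem norm_eval_orbitPoly_add_orbitError_le (hd : 2 ≤ d) (n : ℕ) (ht : 2 ≤ ‖t‖) (i : ℕ) :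
    ‖(orbitPoly d (n + i)).eval t‖ + orbitError d n t
      ≤ (‖(orbitPoly d n).eval t‖ + orbitError d n t) ^ d ^ i := by
  have htP := norm_le_norm_eval_orbitPoly hd ht n
  rw [eval_orbitPoly_add]
  exact norm_iterate_add_le hd (ht.trans htP) htP (orbitError_nonneg d n t)
    (by linarith [orbitError_mul_pow hd n ht, orbitError_le_norm hd n ht]) i

theorem sub_orbitError_pow_le_norm_eval_orbitPoly (hd : 2 ≤ d) (n : ℕ) (ht : 2 ≤ ‖t‖) (i : ℕ) :
    (‖(orbitPoly d n).eval t‖ - orbitError d n t) ^ d ^ i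
      ≤ ‖(orbitPoly d (n + i)).eval t‖ - orbitError d n t := by
  have htP := norm_le_norm_eval_orbitPoly hd ht n
  have hle := orbitError_le_norm hd n ht
  rw [eval_orbitPoly_add]
  exact sub_pow_le_norm_iterate_sub hd (ht.trans htP) htP (orbitError_nonneg d n t)
    (hle.trans htP) (by linarith [orbitError_mul_pow hd n ht]) i

theorem tendsto_orbitError (hd : 2 ≤ d) {n : ℕ} (hn : n ≠ 0) :
    Tendsto (orbitError (𝕜 := 𝕜) d n) (cobounded 𝕜) (𝓝 0) := by
  have hdeg : (X : 𝕜[X]).degree < (orbitPoly d n ^ (d - 1) : 𝕜[X]).degree := by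
    refine degree_lt_degree ?_
    rw [natDegree_X, natDegree_pow, natDegree_orbitPoly hd]
    exact (Nat.one_lt_pow hn hd).trans_le (Nat.le_mul_of_pos_left _ (by omega))
  have hquot := (isLittleO_cobounded_of_degree_lt hdeg).norm_norm.tendsto_div_nhds_zero.const_mul 2
  rw [mul_zero] at hquot
  refine hquot.congr fun t => ?_
  rw [orbitError, eval_pow, eval_X, norm_pow, mul_div_assoc]

end OrbitPoly

/-! ### The multibrot set -/

theorem mem_multibrot_iff {d : ℕ} (hd : 2 ≤ d) {t : ℂ} :
    t ∈ multibrot d ↔ ∀ n, ‖(orbitPoly d n).eval t‖ ≤ 2 := by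
  have hiter (n : ℕ) : (fun z : ℂ => z ^ d + t)^[n + 1] 0 = (orbitPoly d n).eval t := by
    rw [eval_orbitPoly_eq_iterate, Function.iterate_succ_apply, zero_pow (by omega), zero_add]
  rw [multibrot, Set.mem_ofPred_eq, isBounded_iff_forall_norm_le]
  simp only [Set.forall_mem_range]
  constructor
  · rintro ⟨K, hK⟩ k
    by_contra! hk
    obtain ⟨n, hn⟩ := pow_unbounded_of_one_lt K
      (by linarith : 1 < ‖(orbitPoly d k).eval t‖ - 1)
    have hgrowth := sub_one_pow_mul_norm_le_norm_iterate hd hk.le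
      (norm_le_norm_eval_orbitPoly_of_two_le hd hk.le) n
    rw [← eval_orbitPoly_add, ← hiter (k + n)] at hgrowth
    have hpow : 0 ≤ (‖(orbitPoly d k).eval t‖ - 1) ^ n := pow_nonneg (by linarith) n
    have hone : 1 ≤ ‖(orbitPoly d k).eval t‖ := by linarith
    linarith [hK (k + n + 1), le_mul_of_one_le_right hpow hone]
  · refine fun h => ⟨2, fun n => ?_⟩
    cases n with
    | zero => simp
    | succ n => exact hiter n ▸ h n

/-- The lemniscate `‖orbitPoly d n‖ ≤ 2`: the parameters whose critical orbit has not escaped by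
time `n + 1`. -/
def orbitLemniscate (d n : ℕ) : Set ℂ := {t | ‖(orbitPoly d n).eval t‖ ≤ 2}

theorem antitone_orbitLemniscate {d : ℕ} (hd : 2 ≤ d) : Antitone (orbitLemniscate d) := by
  refine antitone_nat_of_succ_le fun n t ht => ?_
  by_contra hn
  exact hn ((norm_eval_orbitPoly_le_add hd (not_le.mp hn).le 1).trans ht)

theorem isCompact_orbitLemniscate {d : ℕ} (hd : 2 ≤ d) (n : ℕ) :
    IsCompact (orbitLemniscate d n) := by
  refine (isCompact_closedBall (0 : ℂ) 2).of_isClosed_subset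
    (isClosed_le (orbitPoly d n).continuous.norm continuous_const) fun t ht => ?_
  have h0 : ‖(orbitPoly d 0).eval t‖ ≤ 2 := antitone_orbitLemniscate hd n.zero_le ht
  simpa [orbitPoly] using h0

theorem multibrot_eq_iInter_orbitLemniscate {d : ℕ} (hd : 2 ≤ d) :
    multibrot d = ⋂ n, orbitLemniscate d n := by
  ext t
  rw [mem_multibrot_iff hd, Set.mem_iInter]
  rfl

theorem isBounded_multibrot {d : ℕ} (hd : 2 ≤ d) : IsBounded (multibrot d) :=
  (isCompact_orbitLemniscate hd 0).isBounded.subset <|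
    (multibrot_eq_iInter_orbitLemniscate hd).trans_subset (Set.iInter_subset _ 0)

theorem exists_orbitLemniscate_add_subset {d : ℕ} (hd : 2 ≤ d) (n : ℕ) {U : Set ℂ}
    (hU : IsOpen U) (hM : multibrot d ⊆ U) : ∃ i, orbitLemniscate d (n + i) ⊆ U := by
  obtain ⟨i, hi⟩ := exists_subset_nhds_of_isCompact (antitone_orbitLemniscate hd).directed_ge
    (isCompact_orbitLemniscate hd) fun t ht =>
      hU.mem_nhds (hM ((multibrot_eq_iInter_orbitLemniscate hd).superset ht))
  exact ⟨i, (antitone_orbitLemniscate hd (Nat.le_add_left i n)).trans hi⟩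

theorem mem_multibrot_of_norm_le {d : ℕ} (hd : 2 ≤ d) {t : ℂ} (ht : ‖t‖ ≤ 1 / 4) :
    t ∈ multibrot d := by
  have hmaps : Set.MapsTo (fun z : ℂ => z ^ d + t) (Metric.closedBall 0 (1 / 2))
      (Metric.closedBall 0 (1 / 2)) := fun z hz => by
    rw [mem_closedBall_zero_iff] at hz ⊢
    calc ‖z ^ d + t‖ ≤ ‖z‖ ^ d + ‖t‖ := by grw [norm_add_le, norm_pow]
      _ ≤ (1 / 2) ^ d + 1 / 4 := by gcongr
      _ ≤ (1 / 2) ^ 2 + 1 / 4 := by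
        gcongr ?_ + _
        exact pow_le_pow_of_le_one (by norm_num) (by norm_num) hd
      _ = 1 / 2 := by norm_num
  refine (Metric.isBounded_closedBall (x := (0 : ℂ)) (r := 1 / 2)).subset ?_
  rintro _ ⟨n, rfl⟩
  exact hmaps.iterate n (Metric.mem_closedBall_self (by norm_num))

theorem nontrivial_multibrot {d : ℕ} (hd : 2 ≤ d) : (multibrot d).Nontrivial :=
  ⟨0, mem_multibrot_of_norm_le hd (by norm_num), 1 / 4, mem_multibrot_of_norm_le hd (by norm_num),
    by norm_num⟩

theorem mul_mem_multibrot {d : ℕ} {ξ t : ℂ} (hξ : ξ ^ d = ξ) (ht : t ∈ multibrot d) :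
    ξ * t ∈ multibrot d := by
  have hsemiconj : Function.Semiconj (ξ * ·) (fun z : ℂ => z ^ d + t)
      (fun z => z ^ d + ξ * t) := fun z => by
    change ξ * (z ^ d + t) = (ξ * z) ^ d + ξ * t
    rw [mul_pow, hξ, mul_add]
  rw [multibrot, Set.mem_ofPred_eq] at ht ⊢
  refine (ht.smul₀ ξ).subset ?_
  rintro _ ⟨n, rfl⟩
  have hn := hsemiconj.iterate_right n 0
  rw [mul_zero] at hn
  exact ⟨_, ⟨n, rfl⟩, hn⟩

theorem image_mul_multibrot {d : ℕ} {ξ : ℂ} (hξ0 : ξ ≠ 0) (hξ : ξ ^ d = ξ) :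
    (fun z : ℂ => ξ * z) '' multibrot d = multibrot d := by
  exact Set.Subset.antisymm (Set.image_subset_iff.mpr fun t ht => mul_mem_multibrot hξ ht)
    fun t ht => ⟨ξ⁻¹ * t, mul_mem_multibrot (by rw [inv_pow, hξ]) ht, mul_inv_cancel_left₀ hξ0 t⟩

/-! ### A Bernstein–Walsh inequality -/

theorem exists_norm_eval_pow_le_mul_norm_eval_orbitPoly {d : ℕ} (hd : 2 ≤ d) {n : ℕ} {q : ℂ[X]}
    (hdeg : q.natDegree = d ^ n) {K : ℝ} (hlc : ‖q.leadingCoeff‖ < K)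
    (hM : ∀ t ∈ multibrot d, ‖q.eval t‖ < K) :
    ∃ i, ∀ t, 2 < ‖(orbitPoly d (n + i)).eval t‖ →
      ‖q.eval t‖ ^ d ^ i ≤ K ^ d ^ i * ‖(orbitPoly d (n + i)).eval t‖ := by
  obtain ⟨i, hi⟩ := exists_orbitLemniscate_add_subset hd n
    (isOpen_lt q.continuous.norm continuous_const) hM
  refine ⟨i, fun t ht => ?_⟩
  have hK : 0 < K := (norm_nonneg _).trans_lt hlc
  rw [← norm_pow, ← eval_pow]
  refine norm_eval_le_mul_norm_eval_of_lemniscate ?_ two_pos ?_ (fun z hz => ?_) ht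
  · rw [natDegree_pow, hdeg, natDegree_orbitPoly hd, pow_add, mul_comm]
  · rw [leadingCoeff_pow, norm_pow, (monic_orbitPoly hd _).leadingCoeff, norm_one, mul_one]
    exact pow_lt_pow_left₀ hlc (norm_nonneg _) (pow_ne_zero _ (by omega))
  · have hqz : ‖q.eval z‖ < K := hi hz.le
    calc ‖(q ^ d ^ i).eval z‖ = ‖q.eval z‖ ^ d ^ i := by rw [eval_pow, norm_pow]
      _ ≤ K ^ d ^ i := by gcongr
      _ ≤ K ^ d ^ i * 2 := le_mul_of_one_le_right (by positivity) one_le_two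

theorem norm_eval_le_mul_pow_of_forall_mem_multibrot {d : ℕ} (hd : 2 ≤ d) {n i : ℕ} {q : ℂ[X]}
    (hdeg : q.natDegree = d ^ (n + i)) {K : ℝ} (hlc : ‖q.leadingCoeff‖ < K)
    (hM : ∀ t ∈ multibrot d, ‖q.eval t‖ < K) {t : ℂ} (ht : 2 < ‖t‖) :
    ‖q.eval t‖ ≤ K * (‖(orbitPoly d n).eval t‖ + orbitError d n t) ^ d ^ i := by
  obtain ⟨j, hj⟩ := exists_norm_eval_pow_le_mul_norm_eval_orbitPoly hd hdeg hlc hM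
  have hK : 0 < K := (norm_nonneg _).trans_lt hlc
  have herr := orbitError_nonneg d n t
  have hupper := norm_eval_orbitPoly_add_orbitError_le hd n ht.le (i + j)
  refine le_of_pow_le_pow_left₀ (n := d ^ j) (pow_ne_zero _ (by omega)) (by positivity) ?_
  calc ‖q.eval t‖ ^ d ^ j ≤ K ^ d ^ j * ‖(orbitPoly d (n + i + j)).eval t‖ :=
        hj t (ht.trans_le (norm_le_norm_eval_orbitPoly hd ht.le _))
    _ ≤ K ^ d ^ j * (‖(orbitPoly d n).eval t‖ + orbitError d n t) ^ d ^ (i + j) := by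
        rw [add_assoc]
        gcongr
        linarith
    _ = (K * (‖(orbitPoly d n).eval t‖ + orbitError d n t) ^ d ^ i) ^ d ^ j := by
        rw [mul_pow, ← pow_mul, pow_add]

/-! ### Affine maps preserving the multibrot set -/

theorem norm_eq_one_of_image_affine_eq {𝕜 E : Type*} [NormedField 𝕜] [NormedAddCommGroup E]
    [NormedSpace 𝕜 E] {S : Set E} (hS : S.Nontrivial) (hSb : IsBounded S) {a : 𝕜} {b : E}
    (h : (fun x => a • x + b) '' S = S) : ‖a‖ = 1 := by
  have himage : (fun x => a • x + b) '' S = (· + b) '' (a • S) := by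
    rw [← Set.image_smul, Set.image_image]
  have hdiam := congrArg Metric.diam h
  rw [himage, (isometry_add_right b).diam_image, diam_smul₀] at hdiam
  exact (mul_eq_right₀ (Metric.diam_pos hS hSb).ne').mp hdiam

theorem natDegree_comp_affine {R : Type*} [Semiring R] [NoZeroDivisors R] (p : R[X]) {a : R}
    (ha : a ≠ 0) (b : R) : (p.comp (C a * X + C b)).natDegree = p.natDegree := by
  rw [natDegree_comp, natDegree_linear ha, mul_one]

theorem leadingCoeff_comp_affine {R : Type*} [Semiring R] [NoZeroDivisors R] (p : R[X]) {a : R}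
    (ha : a ≠ 0) (b : R) :
    (p.comp (C a * X + C b)).leadingCoeff = p.leadingCoeff * a ^ p.natDegree := by
  rw [leadingCoeff_comp (by rw [natDegree_linear ha]; exact one_ne_zero), leadingCoeff_linear ha]

theorem tendsto_affine_cobounded {𝕜 : Type*} [NormedField 𝕜] {a : 𝕜} (ha : a ≠ 0) (b : 𝕜) :
    Tendsto (fun t => a * t + b) (cobounded 𝕜) (cobounded 𝕜) :=
  (tendsto_add_const_cobounded b).comp (tendsto_mul_left_cobounded ha)

section Affine

variable {d : ℕ} {A B : ℂ}

theorem norm_eval_orbitPoly_affine_sub_le (hd : 2 ≤ d) (hA : ‖A‖ = 1)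
    (hM : Set.MapsTo (fun z => A * z + B) (multibrot d) (multibrot d)) (n : ℕ) {t : ℂ}
    (ht : 2 < ‖t‖) (ht' : 2 ≤ ‖A * t + B‖) :
    ‖(orbitPoly d n).eval (A * t + B)‖ - orbitError d n (A * t + B)
      ≤ ‖(orbitPoly d n).eval t‖ + orbitError d n t := by
  have hA0 : A ≠ 0 := norm_ne_zero_iff.mp (by rw [hA]; exact one_ne_zero)
  have herr := orbitError_nonneg d n t
  have herr' := orbitError_nonneg d n (A * t + B)
  refine le_of_frequently_pow_le_mul_pow (K := 3) (by positivity) <|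
    (tendsto_pow_atTop_atTop_of_one_lt hd).frequently <| Frequently.of_forall fun i => ?_
  have hBW := norm_eval_le_mul_pow_of_forall_mem_multibrot hd (n := n) (i := i) (K := 3)
    (q := (orbitPoly d (n + i)).comp (C A * X + C B)) ?_ ?_ ?_ ht
  · simp only [eval_comp, eval_add, eval_mul, eval_C, eval_X] at hBW
    linarith [sub_orbitError_pow_le_norm_eval_orbitPoly hd n ht' i]
  · rw [natDegree_comp_affine _ hA0, natDegree_orbitPoly hd]
  · rw [leadingCoeff_comp_affine _ hA0, (monic_orbitPoly hd _).leadingCoeff, one_mul, norm_pow, hA,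
      one_pow]
    norm_num
  · intro z hz
    simp only [eval_comp, eval_add, eval_mul, eval_C, eval_X]
    exact ((mem_multibrot_iff hd).mp (hM hz) (n + i)).trans_lt (by norm_num)

theorem orbitPoly_comp_affine (hd : 2 ≤ d) (hA : ‖A‖ = 1)
    (hM : Set.MapsTo (fun z => A * z + B) (multibrot d) (multibrot d)) {n : ℕ} (hn : n ≠ 0) :
    (orbitPoly d n).comp (C A * X + C B) = C (A ^ d ^ n) * orbitPoly d n := by
  have hA0 : A ≠ 0 := norm_ne_zero_iff.mp (by rw [hA]; exact one_ne_zero)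
  have hAn : A ^ d ^ n ≠ 0 := pow_ne_zero _ hA0
  have hμ := tendsto_affine_cobounded hA0 B
  have herr : Tendsto (fun t => orbitError d n t + orbitError d n (A * t + B)) (cobounded ℂ)
      (𝓝 0) := by
    simpa using (tendsto_orbitError hd hn).add ((tendsto_orbitError hd hn).comp hμ)
  refine eq_of_norm_eval_le_norm_eval_add ?_ ?_ herr ?_
  · rw [natDegree_comp_affine _ hA0, natDegree_C_mul hAn]
  · rw [leadingCoeff_comp_affine _ hA0, natDegree_orbitPoly hd, leadingCoeff_mul, leadingCoeff_C,
      mul_comm]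
  · have hlarge : ∀ᶠ z : ℂ in cobounded ℂ, 2 < ‖z‖ :=
      tendsto_norm_cobounded_atTop.eventually_gt_atTop 2
    filter_upwards [hlarge, hμ.eventually hlarge] with t ht ht'
    have hle := norm_eval_orbitPoly_affine_sub_le hd hA hM n ht ht'.le
    simp only [eval_comp, eval_add, eval_mul, eval_C, eval_X, norm_mul, norm_pow, hA, one_pow,
      one_mul]
    linarith

theorem pow_eq_self_and_eq_zero_of_mapsTo_multibrot (hd : 2 ≤ d) (hA : ‖A‖ = 1)
    (hM : Set.MapsTo (fun z => A * z + B) (multibrot d) (multibrot d)) : A ^ d = A ∧ B = 0 := by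
  have hP₁ := orbitPoly_comp_affine hd hA hM one_ne_zero
  have hP₂ := orbitPoly_comp_affine hd hA hM two_ne_zero
  have hlinear : C A * X + C B = C (A ^ d ^ 2) * X := by
    have hstep : ((orbitPoly d 1).comp (C A * X + C B)) ^ d + (C A * X + C B)
        = C (A ^ d ^ 2) * (orbitPoly d 1 ^ d + X) := by
      simpa [orbitPoly] using hP₂
    rw [hP₁, mul_pow, ← C_pow, ← pow_mul, pow_one, ← sq] at hstep
    linear_combination hstep
  have hB : B = 0 := by simpa using congrArg (eval 0) hlinear
  have hA₁ : A ^ d + A = A ^ d * 2 := by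
    simpa [hB, orbitPoly, one_add_one_eq_two] using congrArg (eval 1) hP₁
  exact ⟨by linear_combination -hA₁, hB⟩

end Affine

theorem mainTheorem3 (d : ℕ) (hd : 2 ≤ d) :
    (∀ A B : ℂ, (fun z : ℂ => A * z + B) '' multibrot d = multibrot d →
      A ^ (d - 1) = 1 ∧ B = 0) ∧
    (∀ ξ : ℂ, ξ ^ (d - 1) = 1 → (fun z : ℂ => ξ * z) '' multibrot d = multibrot d) := by
  have hpow {a : ℂ} (ha : a ≠ 0) : a ^ (d - 1) = 1 ↔ a ^ d = a := by
    rw [← mul_pow_sub_one (by omega : d ≠ 0) a, mul_eq_left₀ ha]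
  refine ⟨fun A B h => ?_, fun ξ hξ => ?_⟩
  · have hA : ‖A‖ = 1 :=
      norm_eq_one_of_image_affine_eq (nontrivial_multibrot hd) (isBounded_multibrot hd) h
    have hA0 : A ≠ 0 := norm_ne_zero_iff.mp (by rw [hA]; exact one_ne_zero)
    rw [hpow hA0]
    exact pow_eq_self_and_eq_zero_of_mapsTo_multibrot hd hA
      (Set.mapsTo_iff_image_subset.mpr h.subset)
  · have hξ0 : ξ ≠ 0 := ne_zero_pow (by omega : d - 1 ≠ 0) (hξ ▸ one_ne_zero)
    exact image_mul_multibrot hξ0 ((hpow hξ0).mp hξ)
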